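/- \textbf{Setting.} A platoon consists of a leader vehicle (number $0$) and follower vehicles, which at each time $t\in\{0,1,2,\dots\}$ are numbered $1,\dots,n_t$ from front to back. The leader has constant speed $v_0$: with sampling time $\Delta t>0$, its position is $s_0(t)=s_0(0)+v_0\,\Delta t\,t$. A follower with parameters $m,\tau,r,\eta>0$, $C_A,f\in\mathbb R$ and gravity constant $g$ has state $x=[s,v,T]^\top$, output $y=\gamma x=[s,v]^\top$ and dynamics $x(t+1)=\phi(x(t))+u(t)\psi$, where $\psi=[0,0,\Delta t/\tau]^\top$ and $$\phi(x)=\Big[s+v\Delta t,\; v+\tfrac{\Delta t}{m}\big(\tfrac{\eta}{r}T-C_Av^2-mgf\big),\; T-\tfrac{\Delta t}{\tau}T\Big]^\top ;$$ put $h(v)=\frac r\eta(C_Av^2+mgf)$. Parameters may differ from vehicle to vehicle; a subscript $i$ refers to the follower with number $i$ at the current time. For a desired gap $d_0$, the desired output of follower $i$, predicted from time $t$ for time $t+k$, is $y_{\mathrm{des},i}(k|t)=[s_0(t+k)-i\,d_0,\;v_0]^\top$; put $\widetilde d_{i,j}=[(j-i)d_0,0]^\top$. \textbf{Topology.} At each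 time, let $\mathbb N_i$ be the set of followers that send information to follower $i$, and $\mathbb I_i$ the set $\mathbb N_i$ together with the leader $0$ if the leader sends information to $i$. The topology is unidirectional ($j<i$ for all $j\in\mathbb N_i$), and Assumption 1 holds: the directed graph of the platoon contains a spanning tree rooted at the leader. \textbf{Problem (1).} Fix a horizon $N_p\ge1$, input bounds $u_{\min,i},u_{\max,i}$ and weights $Q_i,F_i,G_i\succeq0$ in $\mathbb R^{2\times2}$, $R_i\ge0$ (which may change in time); write $\|z\|_A=z^\top Az$. At time $t$, follower $i$ minimizes over $u_i^p(0|t),\dots,u_i^p(N_p-1|t)$ the cost $$\sum_{k=0}^{N_p-1}\Big(\|y_i^p(k|t)-y_{\mathrm{des},i}(k|t)\|_{Q_i}+R_i\big(u_i^p(k|t)-h_i(v_i^p(k|t))\big)^2+\|y_i^p(k|t)-y_i^a(k|t)\|_{F_i}+\sum_{j\in\mathbb N_i}\|y_i^p(k|t)-y_j^a(k|t)-\widetilde d_{i,j}\|_{G_i}\Big)$$ subject to $x_i^p(0|t)=x_i(t)$, $x_i^p(k+1|t)=\phi_i(x_i^p(k|t))+u_i^p(k|t)\psi_i$, $y_i^p=\gamma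 x_i^p$, $u_i^p(k|t)\in[u_{\min,i},u_{\max,i}]$ for $0\le k<N_p$, $$y_i^p(N_p|t)=\frac1{|\mathbb I_i|}\sum_{j\in\mathbb I_i}\big(y_j^a(N_p|t)+\widetilde d_{i,j}\big),\qquad T_i^p(N_p|t)=h_i(v_i^p(N_p|t)).$$ Here $y_0^a(k|t)$ is the leader's output $[s_0(t+k),v_0]^\top$, and the assumed output $y_i^a(\cdot|t+1)$ of a vehicle which is in the platoon at times $t$ and $t+1$ is the output generated from the state $x_i^p(1|t)$ by the shifted inputs $u_i^p(1|t),\dots,u_i^p(N_p-1|t),h_i(v_i^p(N_p|t))$. Each follower applies $u_i(t)=u_i^p(0|t)$. At the time at which a vehicle joins the platoon (time $0$ for the initial followers) its state, predicted inputs and assumed outputs are arbitrary; at every later time at which it is in the platoon its predicted inputs are an optimal solution of Problem (1). \textbf{Maneuvers.} Starting from $N$ followers, $N_{ci}$ cut-ins (a vehicle from outside enters the platoon at any place) at times $t_{ci,1},\dots,t_{ci,N_{ci}}$ and $N_{co}$ cut-outs (a follower leaves) at times $t_{co,1},\dots,t_{co,N_{co}}$ take place; nothing else changes which vehicles form the platoon,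 or their order. \textbf{Theorem.} Let $$t_{\mathrm{conv}}:=\max_{i,j}\{t_{ci,i},\,t_{co,j}\}+N+N_{ci}-N_{co},$$ where the maximum is $0$ if there are no maneuvers. Then for every $t\ge t_{\mathrm{conv}}$ and every follower $i$ in the platoon at time $t$, $$y_i^p(N_p|t)=y_{\mathrm{des},i}(N_p|t).$$ -/

import Mathlib

namespace Platoon

/-- State `[s, v, T]` of a vehicle: position, velocity, integrated driving/braking torque. -/
abbrev State := Fin 3 → ℝ

/-- Output `[s, v]` of a vehicle: position, velocity. -/
abbrev Output := Fin 2 → ℝ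

/-- The output matrix `γ`. -/
def gam : Matrix (Fin 2) (Fin 3) ℝ := !![1, 0, 0; 0, 1, 0]

/-- The data shared by all vehicles: sampling time, gravity constant, initial position and constant
velocity of the leader, desired distance of consecutive vehicles, and predictive horizon. -/
structure Setting where
  dt : ℝ
  dt_pos : 0 < dt
  g : ℝ
  s0 : ℝ
  v0 : ℝ
  d0 : ℝ
  Np : ℕ
  Np_pos : 0 < Np

/-- The physical parameters of one (heterogeneous) follower vehicle, and its input bounds. -/
structure Vehicle where
  /-- mass -/
  m : ℝ
  /-- coefficient of aerodynamic drag -/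
  CA : ℝ
  /-- coefficient of rolling resistance -/
  f : ℝ
  /-- inertial lag of the longitudinal dynamics -/
  τ : ℝ
  /-- tire radius -/
  r : ℝ
  /-- mechanical efficiency of the driveline -/
  η : ℝ
  uMin : ℝ
  uMax : ℝ
  m_pos : 0 < m
  τ_pos : 0 < τ
  r_pos : 0 < r
  η_pos : 0 < η

/-- The weights in the local cost function of one vehicle. -/
structure Weights where
  Q : Matrix (Fin 2) (Fin 2) ℝ
  R : ℝ
  F : Matrix (Fin 2) (Fin 2) ℝ
  G : Matrix (Fin 2) (Fin 2) ℝ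
  Q_psd : Q.PosSemidef
  R_nonneg : 0 ≤ R
  F_psd : F.PosSemidef
  G_psd : G.PosSemidef

/-- `‖x‖_A = xᵀ A x`. -/
def quad (A : Matrix (Fin 2) (Fin 2) ℝ) (x : Output) : ℝ := x ⬝ᵥ (A.mulVec x)

/-! ### Vehicle dynamics -/

section dynamics

variable (S : Setting) (c : Vehicle)

/-- `Γ(v) = C_A v² + m g f`. -/
noncomputable def resist (v : ℝ) : ℝ := c.CA * v ^ 2 + c.m * S.g * c.f

/-- The external drag `h(v) = (r / η) (C_A v² + m g f)`. -/
noncomputable def drag (v : ℝ) : ℝ := c.r / c.η * (c.CA * v ^ 2 + c.m * S.g * c.f)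

/-- The drift `φ` of the discrete-time dynamics. -/
noncomputable def phi (x : State) : State :=
  ![x 0 + x 1 * S.dt,
    x 1 + S.dt / c.m * (c.η / c.r * x 2 - resist S c (x 1)),
    x 2 - 1 / c.τ * x 2 * S.dt]

/-- The input vector `ψ`. -/
noncomputable def psi : State := ![0, 0, 1 / c.τ * S.dt]

/-- One time step of the dynamics: `φ(x) + u ψ`. -/
noncomputable def step (x : State) (u : ℝ) : State := phi S c x + u • psi S c

/-- The trajectory generated from the state `x` by the inputs `u 0, u 1, …`. -/
noncomputable def traj (x : State) (u : ℕ → ℝ) : ℕ → State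
  | 0 => x
  | k + 1 => step S c (traj x u k) (u k)

/-- The shifted input sequence: the first input is dropped, and after the last one the external
drag at the terminal predicted velocity is appended. Here `x` is the state at which the inputs
`u 0, …, u (Np - 1)` were computed. -/
noncomputable def shiftInput (x : State) (u : ℕ → ℝ) (k : ℕ) : ℝ :=
  if k + 1 < S.Np then u (k + 1) else drag S c (traj S c x u S.Np 1)

/-- The assumed output, at the next time step, of a vehicle which computed the inputs `u` at the
state `x`: the output driven by the shifted inputs from the first predicted state. -/
noncomputable def nextAssumed (x : State) (u : ℕ → ℝ) (k : ℕ) : Output :=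
  gam.mulVec (traj S c (traj S c x u 1) (shiftInput S c x u) k)

end dynamics

/-! ### Leader and desired trajectories -/

section desired

variable (S : Setting)

/-- Position of the leader, which has constant speed, at time `t`. -/
noncomputable def leaderPos (t : ℕ) : ℝ := S.s0 + S.v0 * S.dt * t

/-- Output of the leader at time `t`. -/
noncomputable def leaderOutput (t : ℕ) : Output := ![leaderPos S t, S.v0]

/-- Desired state at time `t` of the vehicle `c` when it is number `n` in the platoon. -/
noncomputable def desState (c : Vehicle) (n t : ℕ) : State :=
  ![leaderPos S t - n * S.d0, S.v0, drag S c S.v0]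

/-- Desired output at time `t` of the vehicle `c` when it is number `n` in the platoon. -/
noncomputable def desOutput (c : Vehicle) (n t : ℕ) : Output := gam.mulVec (desState S c n t)

/-- The desired displacement of vehicle number `i` from vehicle number `j` (the leader is number
`0`); it points backwards, i.e. has negative position component, when `j < i` and `d0 > 0`. -/
noncomputable def gap (i j : ℕ) : Output := ![((j : ℝ) - i) * S.d0, 0]

end desired

/-! ### Communication topology -/

/-- A communication topology for `n` follower vehicles, which are ordered from front to back. The
element `i : Fin n` is follower number `i + 1`. In `Fin (n + 1)`, `0` is the leader and `i.succ` is
the follower `i`. -/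
structure Topology (n : ℕ) where
  /-- `a i j`: follower `j` can send information to follower `i`. -/
  a : Fin n → Fin n → Prop
  /-- `p i`: follower `i` is pinned to the leader. -/
  p : Fin n → Prop

namespace Topology

variable {n : ℕ} (T : Topology n)

open Classical in
/-- `ℕ_i`: the followers which send information to follower `i`. -/
noncomputable def nbr (i : Fin n) : Finset (Fin n) := Finset.univ.filter fun j => T.a i j

open Classical in
/-- `𝕀_i = ℕ_i ∪ ℙ_i`: all vehicles, leader included, which send information to follower `i`. -/
noncomputable def senders (i : Fin n) : Finset (Fin (n + 1)) :=
  (T.nbr i).image Fin.succ ∪ (if T.p i then {0} else ∅)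

/-- The directed graph of the platoon: an edge from `u` to `w` means that `u` sends information
to `w`. -/
def graph : Digraph (Fin (n + 1)) where
  Adj u w := ∃ i : Fin n, w = i.succ ∧ u ∈ T.senders i

/-- Information flows only from front to back. -/
def Unidirectional : Prop := ∀ i j, T.a i j → j < i

end Topology

/-- The digraph `G` contains a spanning tree rooted at `r`: every vertex `w` other than the root has
a parent, joined to it by an edge of `G`, and passing to parents leads from every vertex to `r`. -/
def HasSpanningTree {α : Type*} (G : Digraph α) (r : α) : Prop :=
  ∃ parent : α → α, (∀ w, w ≠ r → G.Adj (parent w) w) ∧ ∀ w, ∃ k : ℕ, parent^[k] w = r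

/-! ### The local optimization problem -/

/-- The information with which a follower solves its optimization problem at one time. -/
structure LocalData (n : ℕ) where
  /-- the physical parameters -/
  c : Vehicle
  /-- the weights of the cost function -/
  W : Weights
  /-- its place among the `n` followers, from front to back -/
  i : Fin n
  /-- the communication topology -/
  T : Topology n
  /-- its current state -/
  x : State
  /-- the current time -/
  t : ℕ
  /-- the assumed outputs `y_j^a(k|t)` of the followers -/
  ya : Fin n → ℕ → Output

section problem

variable (S : Setting) {n : ℕ} (D : LocalData n)

/-- The predicted state `x_i^p(k|t)` under the inputs `u`. -/
noncomputable def predState (u : ℕ → ℝ) (k : ℕ) : State := traj S D.c D.x u k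

/-- The predicted output `y_i^p(k|t)` under the inputs `u`. -/
noncomputable def predOutput (u : ℕ → ℝ) (k : ℕ) : Output := gam.mulVec (predState S D u k)

/-- The assumed output `y_j^a(k|t)` of vehicle `j`, where for the leader (`j = 0`) it is the actual
output. -/
noncomputable def assumedOutput (j : Fin (n + 1)) (k : ℕ) : Output :=
  Fin.cases (motive := fun _ => Output) (leaderOutput S (D.t + k)) (fun j' => D.ya j' k) j

/-- The objective function `J_i`. -/
noncomputable def cost (u : ℕ → ℝ) : ℝ :=
  ∑ k ∈ Finset.range S.Np,
    (quad D.W.Q (predOutput S D u k - desOutput S D.c (D.i + 1) (D.t + k))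
      + D.W.R * (u k - drag S D.c (predState S D u k 1)) ^ 2
      + quad D.W.F (predOutput S D u k - D.ya D.i k)
      + ∑ j ∈ D.T.nbr D.i,
          quad D.W.G (predOutput S D u k - D.ya j k - gap S (D.i + 1) (j + 1)))

/-- The constraints: input bounds, terminal averaging constraint, terminal torque constraint. (The
dynamics and the initial condition are built into `predState`.) -/
structure Feasible (u : ℕ → ℝ) : Prop where
  bounds : ∀ k < S.Np, u k ∈ Set.Icc D.c.uMin D.c.uMax
  terminal_output : predOutput S D u S.Np =
    (1 / ((D.T.senders D.i).card : ℝ)) •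
      ∑ j ∈ D.T.senders D.i, (assumedOutput S D j S.Np + gap S (D.i + 1) j)
  terminal_torque : predState S D u S.Np 2 = drag S D.c (predState S D u S.Np 1)

/-- The inputs `u 0, …, u (Np - 1)` solve the optimization problem (no other values of `u`
matter). -/
def IsOptimal (u : ℕ → ℝ) : Prop :=
  Feasible S D u ∧ ∀ u', Feasible S D u' → cost S D u ≤ cost S D u'

end problem

/-! ### Cut-in and cut-out maneuvers -/

section maneuvers

variable {V : Type*}

/-- `Maneuvers a b l l'`: the list `l'` of followers (from front to back) arises from `l` by `a`
cut-ins (a vehicle from outside enters at any place) and `b` cut-outs (a vehicle leaves), carried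
out one after another in any order. -/
inductive Maneuvers : ℕ → ℕ → List V → List V → Prop
  | none (l : List V) : Maneuvers 0 0 l l
  | cutIn {a b : ℕ} {l : List V} (l₁ l₂ : List V) (w : V) (h : Maneuvers a b l (l₁ ++ l₂))
      (hw : w ∉ l₁ ++ l₂) : Maneuvers (a + 1) b l (l₁ ++ w :: l₂)
  | cutOut {a b : ℕ} {l : List V} (l₁ l₂ : List V) (w : V)
      (h : Maneuvers a b l (l₁ ++ w :: l₂)) : Maneuvers a (b + 1) l (l₁ ++ l₂)

/-- The number of maneuvers, out of those with times `τ`, which take place at time `t`. -/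
def countAt {n : ℕ} (τ : Fin n → ℕ) (t : ℕ) : ℕ := (Finset.univ.filter fun i => τ i = t).card

/-- `roster t` is the list of followers (from front to back) at time `t`, after the maneuvers of
time `t`. It starts from the initial list and changes only by the cut-ins at the times `tci` and the
cut-outs at the times `tco`. -/
structure IsRoster {Nci Nco : ℕ} (initial : List V) (tci : Fin Nci → ℕ) (tco : Fin Nco → ℕ)
    (roster : ℕ → List V) : Prop where
  initial_nodup : initial.Nodup
  zero : Maneuvers (countAt tci 0) (countAt tco 0) initial (roster 0)
  succ : ∀ t, Maneuvers (countAt tci (t + 1)) (countAt tco (t + 1)) (roster t) (roster (t + 1))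

/-- The time of convergence: the time of the last maneuver (`0` if there is none), plus
`N + Nci - Nco`. -/
def tConv (N : ℕ) {Nci Nco : ℕ} (tci : Fin Nci → ℕ) (tco : Fin Nco → ℕ) : ℤ :=
  ((max (Finset.univ.sup tci) (Finset.univ.sup tco) : ℕ) : ℤ) + N + Nci - Nco

end maneuvers

/-! ### The closed loop -/

section closedLoop

variable {V : Type*} (S : Setting) (veh : V → Vehicle) (W : ℕ → V → Weights)
  (roster : ℕ → List V) (topo : ∀ t, Topology (roster t).length)
  (x : ℕ → V → State) (u : ℕ → V → ℕ → ℝ) (ya : ℕ → V → ℕ → Output)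

/-- The local data, at time `t`, of the follower at place `i`. -/
def localData (t : ℕ) (i : Fin (roster t).length) : LocalData (roster t).length where
  c := veh ((roster t).get i)
  W := W t ((roster t).get i)
  i := i
  T := topo t
  x := x t ((roster t).get i)
  t := t
  ya := fun j k => ya t ((roster t).get j) k

/-- A run of the distributed nonlinear model predictive control on a dynamic platoon. Here `x t w`
is the state of vehicle `w` at time `t`, `u t w k` is its predicted input `u^p(k|t)`, and `ya t w k`
is its assumed output `y^a(k|t)`. The time at which a vehicle joins the platoon (for the initial
followers, time `0`) is its initialization: its state, predicted inputs, and assumed outputs are then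
arbitrary; in particular, they may already solve the optimization problem. -/
structure IsRun : Prop where
  /-- The first predicted input is applied. -/
  dynamics : ∀ t, ∀ w ∈ roster t, x (t + 1) w = step S (veh w) (x t w) (u t w 0)
  /-- From the time after it joined, every follower solves its optimization problem. -/
  optimal : ∀ t, ∀ i : Fin (roster (t + 1)).length, (roster (t + 1)).get i ∈ roster t →
    IsOptimal S (localData veh W roster topo x ya (t + 1) i) (u (t + 1) ((roster (t + 1)).get i))
  /-- The assumed outputs are obtained by shifting the solution of the previous time. -/
  assumed : ∀ t, ∀ w ∈ roster t, w ∈ roster (t + 1) → ∀ k ≤ S.Np,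
    ya (t + 1) w k = nextAssumed S (veh w) (x t w) (u t w) k

end closedLoop

end Platoon

namespace Platoon

/-! ### Dynamics -/

/-! Correct terminal predictions spread from the leader backwards, at least one place per time step,
and the terminal constraints alone drive this. The desired state is an equilibrium up to the
leader's motion, so a vehicle whose prediction ends there has, one time step later, an assumed
output that again ends at the desired output (`nextAssumed_of_traj_eq_desState`). If all senders of
a follower are in this situation, or are the leader, the terminal constraint averages equal values
and the torque constraint fixes the third coordinate (`Feasible.traj_eq_desState`). As senders drive
in front, the first `k` followers being correct makes the first `k + 1` correct at the next time
(`IsRun.traj_eq_desState_succ`). After the last maneuver the list of followers is constant, and its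
length `N + Nci - Nco` is the number of steps needed. -/

theorem gam_mulVec (x : State) : gam.mulVec x = ![x 0, x 1] := by
  ext i
  fin_cases i <;> simp [gam, Matrix.mulVec, dotProduct, Fin.sum_univ_three]

theorem gam_mulVec_desState (S : Setting) (c : Vehicle) (n t : ℕ) :
    gam.mulVec (desState S c n t) = ![leaderPos S t - n * S.d0, S.v0] := by
  simp [gam_mulVec, desState]

theorem leaderPos_succ (S : Setting) (t : ℕ) :
    leaderPos S (t + 1) = leaderPos S t + S.v0 * S.dt := by
  simp only [leaderPos]
  push_cast
  ring

/-- From the desired state every input leads to the desired output of the next time. -/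
theorem gam_mulVec_step_desState (S : Setting) (c : Vehicle) (n t : ℕ) (a : ℝ) :
    gam.mulVec (step S c (desState S c n t) a) = gam.mulVec (desState S c n (t + 1)) := by
  have hr := c.r_pos.ne'
  have hη := c.η_pos.ne'
  -- At the torque `drag S c S.v0` the drive force cancels the resistance, so the velocity persists;
  -- the input acts only on the torque, which the output does not see.
  have h : c.η / c.r * drag S c S.v0 - resist S c S.v0 = 0 := by
    simp only [drag, resist]
    field_simp
    ring
  rw [gam_mulVec_desState, gam_mulVec, leaderPos_succ]
  ext i
  fin_cases i
  · simp [step, phi, psi, desState]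
    ring
  · simp [step, phi, psi, desState, h]

/-- Before its last step, the shifted input sequence reproduces the original trajectory. -/
theorem traj_shiftInput (S : Setting) (c : Vehicle) (x : State) (u : ℕ → ℝ) (k : ℕ)
    (hk : k + 1 ≤ S.Np) :
    traj S c (traj S c x u 1) (shiftInput S c x u) k = traj S c x u (k + 1) := by
  induction k with
  | zero => rfl
  | succ k ih =>
    rw [traj, ih (by omega), shiftInput, if_pos (by omega)]
    rfl

/-- If the predicted terminal state is the desired one, so is the next assumed terminal output. -/
theorem nextAssumed_of_traj_eq_desState (S : Setting) (c : Vehicle) (x : State) (u : ℕ → ℝ)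
    (n t : ℕ) (h : traj S c x u S.Np = desState S c n t) :
    nextAssumed S c x u S.Np = desOutput S c n (t + 1) := by
  -- The first `Np - 1` shifted steps already reach the old terminal state. The last one starts at
  -- the desired state, where the value of the appended input does not affect the output.
  obtain ⟨m, hm⟩ := Nat.exists_eq_succ_of_ne_zero S.Np_pos.ne'
  rw [nextAssumed, desOutput, hm, Nat.succ_eq_add_one, traj,
    traj_shiftInput S c x u m (by omega), ← Nat.succ_eq_add_one, ← hm, h,
    gam_mulVec_step_desState]

/-- Vehicle parameters enter the desired state only through the torque, so heterogeneous vehicles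
can be compared by outputs. -/
theorem desOutput_add_gap (S : Setting) (c c' : Vehicle) (i j t : ℕ) :
    desOutput S c j t + gap S i j = desOutput S c' i t := by
  rw [desOutput, desOutput, gam_mulVec_desState, gam_mulVec_desState, gap]
  ext k
  fin_cases k
  · simp
    ring
  · simp

theorem leaderOutput_add_gap (S : Setting) (c : Vehicle) (i t : ℕ) :
    leaderOutput S t + gap S i 0 = desOutput S c i t := by
  rw [desOutput, gam_mulVec_desState, gap, leaderOutput]
  ext k
  fin_cases k
  · simp
    ring
  · simp

/-! ### Topology -/

/-- The parent in the spanning tree is a sender. This keeps the divisor of the terminal average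
nonzero. -/
theorem Topology.senders_nonempty {n : ℕ} (T : Topology n) (h : HasSpanningTree T.graph 0)
    (i : Fin n) : (T.senders i).Nonempty := by
  obtain ⟨parent, hp, -⟩ := h
  obtain ⟨j, hj, hmem⟩ := hp i.succ (Fin.succ_ne_zero i)
  rw [← Fin.succ_injective _ hj] at hmem
  exact ⟨_, hmem⟩

theorem Topology.eq_zero_or_of_mem_senders {n : ℕ} (T : Topology n) (h : T.Unidirectional)
    {i : Fin n} {j : Fin (n + 1)} (hj : j ∈ T.senders i) :
    j = 0 ∨ ∃ j' : Fin n, j = j'.succ ∧ j' < i := by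
  rw [Topology.senders, Finset.mem_union, Finset.mem_image] at hj
  rcases hj with ⟨j', hj', rfl⟩ | hj
  · exact .inr ⟨j', rfl, h i j' (by simpa [Topology.nbr] using hj')⟩
  · left
    split_ifs at hj
    · simpa using hj
    · simp at hj

/-! ### Terminal states of feasible predictions -/

/-- If all senders have the desired assumed terminal output, then a feasible prediction ends in the
desired state. -/
theorem Feasible.traj_eq_desState {S : Setting} {n : ℕ} {D : LocalData n} {u : ℕ → ℝ}
    (hu : Feasible S D u) (hne : (D.T.senders D.i).Nonempty)
    (h : ∀ j ∈ D.T.senders D.i, assumedOutput S D j S.Np + gap S (D.i + 1) j =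
      desOutput S D.c (D.i + 1) (D.t + S.Np)) :
    traj S D.c D.x u S.Np = desState S D.c (D.i + 1) (D.t + S.Np) := by
  have hcard : ((D.T.senders D.i).card : ℝ) ≠ 0 :=
    Nat.cast_ne_zero.2 (Finset.card_pos.2 hne).ne'
  have hout := hu.terminal_output
  rw [Finset.sum_congr rfl h, Finset.sum_const, ← Nat.cast_smul_eq_nsmul ℝ, smul_smul,
    one_div_mul_cancel hcard, one_smul, predOutput, desOutput, gam_mulVec, gam_mulVec,
    predState] at hout
  have h0 := congrFun hout 0
  have h1 := congrFun hout 1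
  have h2 := hu.terminal_torque
  simp only [Matrix.cons_val_zero, Matrix.cons_val_one] at h0 h1
  rw [predState, h1] at h2
  ext k
  fin_cases k
  · exact h0
  · exact h1
  · simpa [desState] using h2

/-! ### Rosters -/

section roster

variable {V : Type*}

/-- Stated additively to avoid truncated subtraction. -/
theorem Maneuvers.length_add {a b : ℕ} {l l' : List V} (h : Maneuvers a b l l') :
    l'.length + b = l.length + a := by
  induction h with
  | none => rfl
  | cutIn l₁ l₂ w _ _ ih =>
    simp only [List.length_append, List.length_cons] at ih ⊢
    omega
  | cutOut l₁ l₂ w _ ih =>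
    simp only [List.length_append, List.length_cons] at ih ⊢
    omega

theorem Maneuvers.eq_of_zero {l l' : List V} (h : Maneuvers 0 0 l l') : l' = l := by
  cases h
  rfl

theorem card_filter_le_succ {n : ℕ} (τ : Fin n → ℕ) (t : ℕ) :
    (Finset.univ.filter fun i => τ i ≤ t + 1).card =
      (Finset.univ.filter fun i => τ i ≤ t).card + countAt τ (t + 1) := by
  rw [countAt, ← Finset.card_union_of_disjoint]
  · congr 1
    ext i
    simp only [Finset.mem_filter, Finset.mem_union, Finset.mem_univ, true_and]
    omega
  · rw [Finset.disjoint_filter]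
    intro i _ h
    omega

theorem countAt_eq_zero {n : ℕ} {τ : Fin n → ℕ} {t : ℕ} (h : Finset.univ.sup τ < t) :
    countAt τ t = 0 := by
  rw [countAt, Finset.card_eq_zero, Finset.filter_eq_empty_iff]
  intro i hi hit
  have := Finset.le_sup (f := τ) hi
  omega

variable {initial : List V} {Nci Nco : ℕ} {tci : Fin Nci → ℕ} {tco : Fin Nco → ℕ}
  {roster : ℕ → List V}

theorem IsRoster.length_add (h : IsRoster initial tci tco roster) (t : ℕ) :
    (roster t).length + (Finset.univ.filter fun i => tco i ≤ t).card =
      initial.length + (Finset.univ.filter fun i => tci i ≤ t).card := by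
  induction t with
  | zero => simpa [countAt] using h.zero.length_add
  | succ t ih =>
    have := (h.succ t).length_add
    rw [card_filter_le_succ, card_filter_le_succ]
    omega

theorem IsRoster.length_add_of_le (h : IsRoster initial tci tco roster) {t : ℕ}
    (ht : max (Finset.univ.sup tci) (Finset.univ.sup tco) ≤ t) :
    (roster t).length + Nco = initial.length + Nci := by
  have key := h.length_add t
  rw [max_le_iff, Finset.sup_le_iff, Finset.sup_le_iff] at ht
  rwa [Finset.filter_true_of_mem ht.1, Finset.filter_true_of_mem ht.2, Finset.card_univ,
    Finset.card_univ, Fintype.card_fin, Fintype.card_fin] at key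

theorem IsRoster.succ_eq (h : IsRoster initial tci tco roster) {t : ℕ}
    (ht : max (Finset.univ.sup tci) (Finset.univ.sup tco) ≤ t) : roster (t + 1) = roster t := by
  have key := h.succ t
  rw [max_le_iff] at ht
  rw [countAt_eq_zero (by omega), countAt_eq_zero (by omega)] at key
  exact key.eq_of_zero

end roster

/-! ### Convergence -/

section convergence

variable {V : Type*} {S : Setting} {veh : V → Vehicle} {W : ℕ → V → Weights}
  {roster : ℕ → List V} {topo : ∀ t, Topology (roster t).length}
  {x : ℕ → V → State} {u : ℕ → V → ℕ → ℝ} {ya : ℕ → V → ℕ → Output}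

/-- If the followers do not change from `t` to `t + 1`, and at time `t` the first `k` of them predict
the desired terminal state, then at time `t + 1` the first `k + 1` of them do. -/
theorem IsRun.traj_eq_desState_succ (hrun : IsRun S veh W roster topo x u ya) {t k : ℕ}
    (huni : (topo (t + 1)).Unidirectional) (htree : HasSpanningTree (topo (t + 1)).graph 0)
    (heq : roster (t + 1) = roster t)
    (h : ∀ (i : ℕ) (w : V), i < k → (roster t)[i]? = some w →
      traj S (veh w) (x t w) (u t w) S.Np = desState S (veh w) (i + 1) (t + S.Np))
    (i : ℕ) (w : V) (hik : i < k + 1) (hw : (roster (t + 1))[i]? = some w) :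
    traj S (veh w) (x (t + 1) w) (u (t + 1) w) S.Np =
      desState S (veh w) (i + 1) (t + 1 + S.Np) := by
  have hmem : ∀ v, v ∈ roster (t + 1) → v ∈ roster t := fun v hv => heq ▸ hv
  obtain ⟨hi, rfl⟩ := List.getElem?_eq_some_iff.1 hw
  -- An unchanged roster means that no vehicle is in its arbitrary initialization at time `t + 1`.
  have hopt := hrun.optimal t ⟨i, hi⟩ (hmem _ (List.get_mem _ _))
  refine hopt.1.traj_eq_desState (Topology.senders_nonempty _ htree _) fun j hj => ?_
  obtain rfl | ⟨j', rfl, hj'⟩ := Topology.eq_zero_or_of_mem_senders _ huni hj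
  · exact leaderOutput_add_gap S _ _ _
  · have hlt : (j' : ℕ) < i := hj'
    have hget : (roster t)[(j' : ℕ)]? = some ((roster (t + 1)).get j') := by
      rw [← heq]
      exact List.getElem?_eq_getElem j'.2
    have hya : ya (t + 1) ((roster (t + 1)).get j') S.Np =
        desOutput S (veh ((roster (t + 1)).get j')) (j' + 1) (t + 1 + S.Np) := by
      rw [hrun.assumed t _ (hmem _ (List.get_mem _ _)) (List.get_mem _ _) _ le_rfl,
        nextAssumed_of_traj_eq_desState S _ _ _ _ _ (h j' _ (by omega) hget), Nat.add_right_comm]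
    have := desOutput_add_gap S (veh ((roster (t + 1)).get j'))
      (veh ((roster (t + 1)).get ⟨i, hi⟩)) (i + 1) (j' + 1) (t + 1 + S.Np)
    rw [← hya] at this
    simpa [assumedOutput, localData] using this

/-- If the followers do not change from time `t₀` on, then from time `t₀ + k` on the first `k` of
them predict the desired terminal state. -/
theorem IsRun.traj_eq_desState (hrun : IsRun S veh W roster topo x u ya)
    (huni : ∀ t, (topo t).Unidirectional) (htree : ∀ t, HasSpanningTree (topo t).graph 0)
    {t₀ : ℕ} (heq : ∀ t, t₀ ≤ t → roster (t + 1) = roster t) (k t : ℕ) (ht : t₀ + k ≤ t)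
    (i : ℕ) (w : V) (hik : i < k) (hw : (roster t)[i]? = some w) :
    traj S (veh w) (x t w) (u t w) S.Np = desState S (veh w) (i + 1) (t + S.Np) := by
  induction k generalizing t i w with
  | zero => omega
  | succ k ih =>
    obtain ⟨s, rfl⟩ : ∃ s, t = s + 1 := ⟨t - 1, by omega⟩
    exact hrun.traj_eq_desState_succ (huni _) (htree _) (heq s (by omega))
      (fun i w => ih s (by omega) i w) i w hik hw

end convergence

end Platoon

open Platoon in
theorem theorem2 {V : Type*} (S : Setting) (veh : V → Vehicle) (W : ℕ → V → Weights)
    (N Nci Nco : ℕ) (initial : List V) (hN : initial.length = N)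
    (tci : Fin Nci → ℕ) (tco : Fin Nco → ℕ) (roster : ℕ → List V)
    (hroster : IsRoster initial tci tco roster)
    (topo : ∀ t, Topology (roster t).length)
    (huni : ∀ t, (topo t).Unidirectional)
    (htree : ∀ t, HasSpanningTree (topo t).graph 0)
    (x : ℕ → V → State) (u : ℕ → V → ℕ → ℝ) (ya : ℕ → V → ℕ → Output)
    (hrun : IsRun S veh W roster topo x u ya) :
    ∀ t : ℕ, tConv N tci tco ≤ (t : ℤ) → ∀ i : Fin (roster t).length,
      predOutput S (localData veh W roster topo x ya t i) (u t ((roster t).get i)) S.Np =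
        desOutput S (veh ((roster t).get i)) (i + 1) (t + S.Np) := by
  intro t ht i
  rw [tConv] at ht
  -- The length formula at the last maneuver time gives `Nco ≤ N + Nci`; hence the integer bound
  -- `ht` puts `t` at or after that time.
  have hlen := hroster.length_add_of_le (t := t)
    (by have := hroster.length_add_of_le le_rfl; omega)
  have key := hrun.traj_eq_desState huni htree (fun s => hroster.succ_eq) (roster t).length t
    (by omega) i _ i.2 (List.getElem?_eq_getElem i.2)
  exact congrArg gam.mulVec key
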